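/- Let $\alpha,\beta>-1$ be real and let $w(x)=(1-x)^{\alpha}(1+x)^{\beta}$ for $x\in[-1,1]$. Let $\{\mathcal P_n^{(\alpha,\beta)}\}_{n\ge 0}$ be the monic Jacobi polynomials, i.e. the unique sequence of real polynomials such that $\mathcal P_n^{(\alpha,\beta)}$ is monic of degree $n$ and $\int_{-1}^{1}\mathcal P_m^{(\alpha,\beta)}(x)\,\mathcal P_n^{(\alpha,\beta)}(x)\,w(x)\,dx=0$ whenever $m\ne n$. Write $(\lambda)_0=1$ and $(\lambda)_n=\lambda(\lambda+1)\cdots(\lambda+n-1)$ for $n\ge 1$. Then for every integer $n\ge 0$, $$\mathcal P_n^{(\alpha,\beta)}(-1)=\frac{(-1)^n\,2^n\,(\beta+1)_n}{(\alpha+\beta+n+1)_n} \qquad\text{and}\qquad \mathcal P_n^{(\alpha,\beta)}(1)=\frac{2^n\,(\alpha+1)_n}{(\alpha+\beta+n+1)_n}.$$ -/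

import Mathlib

/-- The Jacobi weight `w(x) = (1 - x)^α (1 + x)^β`, used on `[-1, 1]`. -/
noncomputable def jacobiWeight (α β x : ℝ) : ℝ := (1 - x) ^ α * (1 + x) ^ β

/-- The pairing `∫_{-1}^{1} p(x) q(x) w(x) dx` of real polynomials given by the Jacobi weight. -/
noncomputable def jacobiPairing (α β : ℝ) (p q : Polynomial ℝ) : ℝ :=
  ∫ x in (-1 : ℝ)..1, p.eval x * q.eval x * jacobiWeight α β x

/-- `P 0, P 1, …` are monic, `P n` has degree `n`, and
`∫_{-1}^{1} P m (x) P n (x) w(x) dx = 0` for `m ≠ n`. -/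
structure IsMonicJacobiFamily (α β : ℝ) (P : ℕ → Polynomial ℝ) : Prop where
  monic : ∀ n, (P n).Monic
  natDegree_eq : ∀ n, (P n).natDegree = n
  orthogonal : ∀ m n, m ≠ n → jacobiPairing α β (P m) (P n) = 0

/-- The monic Jacobi polynomials: the monic orthogonal polynomials of the Jacobi weight, built from
`1, x, x², …` by orthogonalisation. For `α, β > -1` they are the one and only sequence with the
property `IsMonicJacobiFamily α β`, see `isMonicJacobiFamily_iff`. -/
noncomputable def monicJacobi (α β : ℝ) (n : ℕ) : Polynomial ℝ :=
  Polynomial.X ^ n - ∑ k : Fin n,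
    Polynomial.C (jacobiPairing α β (Polynomial.X ^ n) (monicJacobi α β k) /
      jacobiPairing α β (monicJacobi α β k) (monicJacobi α β k)) * monicJacobi α β k
termination_by n
decreasing_by all_goals exact k.isLt

theorem jacobiWeight_intervalIntegrable {α β : ℝ} (hα : -1 < α) (hβ : -1 < β) :
    IntervalIntegrable (jacobiWeight α β) MeasureTheory.volume (-1) 1 := by
  have h1 : IntervalIntegrable (jacobiWeight α β) MeasureTheory.volume (-1) 0 := by
    have hb : IntervalIntegrable (fun x : ℝ => (1 + x) ^ β) MeasureTheory.volume (-1) 0 := by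
      have := (intervalIntegral.intervalIntegrable_rpow' (a := 0) (b := 1) hβ).comp_add_left 1
      simpa using this
    refine hb.continuousOn_mul (g := fun x : ℝ => (1 - x) ^ α) ?_
    intro x hx
    rw [Set.uIcc_of_le (by norm_num)] at hx
    exact (ContinuousAt.rpow_const (by fun_prop)
      (Or.inl (by have := hx.2; linarith))).continuousWithinAt
  have h2 : IntervalIntegrable (jacobiWeight α β) MeasureTheory.volume 0 1 := by
    have hb : IntervalIntegrable (fun x : ℝ => (1 - x) ^ α) MeasureTheory.volume 0 1 := by
      have := (intervalIntegral.intervalIntegrable_rpow' (a := 0) (b := 1) hα).comp_sub_left 1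
      simpa using this.symm
    refine hb.mul_continuousOn (g := fun x : ℝ => (1 + x) ^ β) ?_
    intro x hx
    rw [Set.uIcc_of_le (by norm_num)] at hx
    exact (ContinuousAt.rpow_const (by fun_prop)
      (Or.inl (by have := hx.1; linarith))).continuousWithinAt
  exact h1.trans h2

theorem jacobiPairing_intervalIntegrable {α β : ℝ} (hα : -1 < α) (hβ : -1 < β)
    (p q : Polynomial ℝ) :
    IntervalIntegrable (fun x => p.eval x * q.eval x * jacobiWeight α β x)
      MeasureTheory.volume (-1) 1 :=
  (jacobiWeight_intervalIntegrable hα hβ).continuousOn_mul (g := fun x => p.eval x * q.eval x)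
    (by fun_prop)

theorem jacobiPairing_comm (α β : ℝ) (p q : Polynomial ℝ) :
    jacobiPairing α β p q = jacobiPairing α β q p := by
  simp only [jacobiPairing, mul_comm (p.eval _)]

theorem jacobiPairing_C_mul (α β c : ℝ) (p q : Polynomial ℝ) :
    jacobiPairing α β (Polynomial.C c * p) q = c * jacobiPairing α β p q := by
  rw [jacobiPairing, jacobiPairing, ← intervalIntegral.integral_const_mul]
  simp [mul_assoc]

theorem jacobiPairing_add {α β : ℝ} (hα : -1 < α) (hβ : -1 < β) (p q r : Polynomial ℝ) :
    jacobiPairing α β (p + q) r = jacobiPairing α β p r + jacobiPairing α β q r := by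
  rw [jacobiPairing, jacobiPairing, jacobiPairing, ← intervalIntegral.integral_add
    (jacobiPairing_intervalIntegrable hα hβ p r) (jacobiPairing_intervalIntegrable hα hβ q r)]
  simp [add_mul]

theorem jacobiPairing_sub {α β : ℝ} (hα : -1 < α) (hβ : -1 < β) (p q r : Polynomial ℝ) :
    jacobiPairing α β (p - q) r = jacobiPairing α β p r - jacobiPairing α β q r := by
  rw [jacobiPairing, jacobiPairing, jacobiPairing, ← intervalIntegral.integral_sub
    (jacobiPairing_intervalIntegrable hα hβ p r) (jacobiPairing_intervalIntegrable hα hβ q r)]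
  simp [sub_mul]

theorem jacobiPairing_sum {α β : ℝ} (hα : -1 < α) (hβ : -1 < β) {ι : Type*} (s : Finset ι)
    (p : ι → Polynomial ℝ) (r : Polynomial ℝ) :
    jacobiPairing α β (∑ i ∈ s, p i) r = ∑ i ∈ s, jacobiPairing α β (p i) r := by
  classical
  induction s using Finset.induction_on with
  | empty => simp [jacobiPairing]
  | insert a s ha ih => rw [Finset.sum_insert ha, Finset.sum_insert ha, jacobiPairing_add hα hβ, ih]

theorem jacobiPairing_self_pos {α β : ℝ} (hα : -1 < α) (hβ : -1 < β) {p : Polynomial ℝ}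
    (hp : p ≠ 0) : 0 < jacobiPairing α β p p := by
  have hpos : ∀ x ∈ Set.Ioo (-1 : ℝ) 1, 0 < jacobiWeight α β x := fun x hx =>
    mul_pos (Real.rpow_pos_of_pos (by linarith [hx.2]) _)
      (Real.rpow_pos_of_pos (by linarith [hx.1]) _)
  have hfin : (↑p.roots.toFinset : Set ℝ).Finite := Finset.finite_toSet _
  rw [jacobiPairing, intervalIntegral.integral_pos_iff_support_of_nonneg_ae']
  · refine ⟨by norm_num, ?_⟩
    have hsub : Set.Ioo (-1 : ℝ) 1 \ (↑p.roots.toFinset : Set ℝ) ⊆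
        Function.support (fun x => p.eval x * p.eval x * jacobiWeight α β x) ∩
          Set.Ioc (-1) 1 := by
      rintro x ⟨hx, hr⟩
      refine ⟨?_, hx.1, hx.2.le⟩
      have h0 : p.eval x ≠ 0 := fun h => hr (by simp [hp, Polynomial.IsRoot, h])
      exact mul_ne_zero (mul_ne_zero h0 h0) (hpos x hx).ne'
    refine lt_of_lt_of_le ?_ (MeasureTheory.measure_mono hsub)
    rw [MeasureTheory.measure_sdiff_null (hfin.measure_zero _)]
    simp
  · rw [Set.uIoc_of_le (by norm_num)]
    refine (MeasureTheory.ae_restrict_iff' measurableSet_Ioc).2 (Filter.Eventually.of_forall ?_)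
    intro x hx
    exact mul_nonneg (mul_self_nonneg _)
      (mul_nonneg (Real.rpow_nonneg (by linarith [hx.2]) _)
        (Real.rpow_nonneg (by linarith [hx.1]) _))
  · exact jacobiPairing_intervalIntegrable hα hβ p p

theorem monicJacobi_monic_degree (α β : ℝ) (n : ℕ) :
    (monicJacobi α β n).Monic ∧ (monicJacobi α β n).degree = n := by
  induction n using Nat.strong_induction_on with
  | _ n ih =>
    have hlt : (∑ k : Fin n,
        Polynomial.C (jacobiPairing α β (Polynomial.X ^ n) (monicJacobi α β k) /
          jacobiPairing α β (monicJacobi α β k) (monicJacobi α β k)) *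
            monicJacobi α β k).degree < (n : WithBot ℕ) := by
      refine lt_of_le_of_lt (Polynomial.degree_sum_le _ _) ?_
      refine (Finset.sup_lt_iff (WithBot.bot_lt_coe n)).2 fun k _ => ?_
      rw [Polynomial.C_mul']
      refine lt_of_le_of_lt (Polynomial.degree_smul_le _ _) ?_
      rw [(ih k k.isLt).2]
      exact WithBot.coe_lt_coe.2 k.isLt
    rw [monicJacobi]
    refine ⟨Polynomial.monic_X_pow_sub hlt, ?_⟩
    rw [Polynomial.degree_sub_eq_left_of_degree_lt (by rwa [Polynomial.degree_X_pow]),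
      Polynomial.degree_X_pow]

theorem monicJacobi_orthogonal_of_lt {α β : ℝ} (hα : -1 < α) (hβ : -1 < β) (n : ℕ) :
    ∀ m < n, jacobiPairing α β (monicJacobi α β n) (monicJacobi α β m) = 0 := by
  induction n using Nat.strong_induction_on with
  | _ n ih =>
    intro m hm
    have hne : jacobiPairing α β (monicJacobi α β m) (monicJacobi α β m) ≠ 0 :=
      (jacobiPairing_self_pos hα hβ (monicJacobi_monic_degree α β m).1.ne_zero).ne'
    rw [monicJacobi, jacobiPairing_sub hα hβ, jacobiPairing_sum hα hβ,
      Finset.sum_eq_single (⟨m, hm⟩ : Fin n)]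
    · rw [jacobiPairing_C_mul, div_mul_cancel₀ _ hne, sub_self]
    · intro k _ hk
      rw [jacobiPairing_C_mul]
      have hkm : (k : ℕ) ≠ m := fun h => hk (Fin.ext h)
      rcases lt_or_gt_of_ne hkm with h | h
      · rw [jacobiPairing_comm α β _ (monicJacobi α β m), ih m hm k h, mul_zero]
      · rw [ih k k.isLt m h, mul_zero]
    · simp

theorem isMonicJacobiFamily_monicJacobi {α β : ℝ} (hα : -1 < α) (hβ : -1 < β) :
    IsMonicJacobiFamily α β (monicJacobi α β) where
  monic n := (monicJacobi_monic_degree α β n).1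
  natDegree_eq n := Polynomial.natDegree_eq_of_degree_eq_some (monicJacobi_monic_degree α β n).2
  orthogonal m n h := by
    rcases lt_or_gt_of_ne h with h | h
    · rw [jacobiPairing_comm, monicJacobi_orthogonal_of_lt hα hβ n m h]
    · exact monicJacobi_orthogonal_of_lt hα hβ m n h

theorem IsMonicJacobiFamily.degree_eq {α β : ℝ} {P : ℕ → Polynomial ℝ}
    (hP : IsMonicJacobiFamily α β P) (n : ℕ) : (P n).degree = n := by
  rw [Polynomial.degree_eq_natDegree (hP.monic n).ne_zero, hP.natDegree_eq]

theorem IsMonicJacobiFamily.pairing_eq_zero {α β : ℝ} (hα : -1 < α) (hβ : -1 < β)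
    {P : ℕ → Polynomial ℝ} (hP : IsMonicJacobiFamily α β P) (n d : ℕ) (hd : d ≤ n) :
    ∀ q : Polynomial ℝ, q.degree < d → jacobiPairing α β q (P n) = 0 := by
  induction d with
  | zero =>
    intro q hq
    have : q = 0 := by simpa [Nat.WithBot.lt_zero_iff] using hq
    simp [this, jacobiPairing]
  | succ d ih =>
    intro q hq
    have hc : (q - Polynomial.C (q.coeff d) * P d).degree < (d : WithBot ℕ) := by
      rw [Polynomial.degree_lt_iff_coeff_zero]
      intro m hm
      rw [Polynomial.coeff_sub, Polynomial.coeff_C_mul]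
      rcases hm.eq_or_lt with rfl | hm
      · have h1 : (P d).coeff d = 1 := by
          have := (hP.monic d).coeff_natDegree
          rwa [hP.natDegree_eq] at this
        rw [h1, mul_one, sub_self]
      · rw [(Polynomial.degree_lt_iff_coeff_zero _ _).1 hq m hm,
          Polynomial.coeff_eq_zero_of_natDegree_lt (p := P d) (by rwa [hP.natDegree_eq]),
          mul_zero, sub_zero]
    have h := ih (by omega) _ hc
    rwa [jacobiPairing_sub hα hβ, jacobiPairing_C_mul, hP.orthogonal d n (by omega), mul_zero,
      sub_zero] at h

/-- Existence and uniqueness: `monicJacobi α β` is exactly the sequence of monic orthogonal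
polynomials of the Jacobi weight. -/
theorem isMonicJacobiFamily_iff {α β : ℝ} (hα : -1 < α) (hβ : -1 < β) (P : ℕ → Polynomial ℝ) :
    IsMonicJacobiFamily α β P ↔ P = monicJacobi α β := by
  have hJ := isMonicJacobiFamily_monicJacobi hα hβ
  constructor
  · intro hP
    funext n
    by_contra hne
    have hlt : (P n - monicJacobi α β n).degree < (n : WithBot ℕ) := by
      have := Polynomial.degree_sub_lt_left (p := P n) (q := monicJacobi α β n)
        (by rw [hP.degree_eq, hJ.degree_eq]) (hP.monic n).ne_zero
        (by rw [(hP.monic n).leadingCoeff, (hJ.monic n).leadingCoeff])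
      rwa [hP.degree_eq] at this
    have h1 := hP.pairing_eq_zero hα hβ n n le_rfl _ hlt
    have h2 := hJ.pairing_eq_zero hα hβ n n le_rfl _ hlt
    have h3 := jacobiPairing_self_pos hα hβ (sub_ne_zero.2 hne)
    rw [jacobiPairing_sub hα hβ, jacobiPairing_comm _ _ (P n),
      jacobiPairing_comm _ _ (monicJacobi α β n), h1, h2, sub_self] at h3
    exact lt_irrefl _ h3
  · rintro rfl
    exact hJ

/-! The raising operator lifts degree by one and lowers both parameters by one. Integration by parts
has no boundary terms, so it is, up to sign, adjoint to differentiation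
(`jacobiPairing_jacobiRaise`); hence it sends the monic Jacobi polynomial of degree `m` for `(α+1,
β+1)` to one of degree `m+1` orthogonal to all lower degrees for `(α, β)`. By uniqueness this is a
multiple of the next Jacobi polynomial, the leading coefficient giving the factor `-(α+β+m+2)`
(`monicJacobi_succ`). At `±1` the factor `1 - x²` kills the derivative term, so each endpoint value
satisfies a one-term recursion, which unwinds into Pochhammer symbols. -/

/-- The raising operator `q ↦ w⁻¹ ((1 - x ^ 2) w q)'` of the Jacobi weight
`w(x) = (1 - x)^α (1 + x)^β`, as an operator on polynomials. -/
noncomputable def jacobiRaise (α β : ℝ) (q : Polynomial ℝ) : Polynomial ℝ :=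
  (1 - Polynomial.X ^ 2) * Polynomial.derivative q +
    Polynomial.C (β + 1) * ((1 - Polynomial.X) * q) -
      Polynomial.C (α + 1) * ((1 + Polynomial.X) * q)

theorem jacobiRaise_eval (α β : ℝ) (q : Polynomial ℝ) (x : ℝ) :
    (jacobiRaise α β q).eval x = (1 - x ^ 2) * (Polynomial.derivative q).eval x +
      (β + 1) * ((1 - x) * q.eval x) - (α + 1) * ((1 + x) * q.eval x) := by
  simp [jacobiRaise]

theorem jacobiRaise_mul (α β : ℝ) (q r : Polynomial ℝ) :
    jacobiRaise α β (q * r) =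
      jacobiRaise α β q * r + (1 - Polynomial.X ^ 2) * (q * Polynomial.derivative r) := by
  simp only [jacobiRaise, Polynomial.derivative_mul]
  ring

/-- The term `-x² q'` contributes `-k`, and the two zeroth-order terms contribute `-(β+1)` and
`-(α+1)`. -/
theorem jacobiRaise_coeff_succ (α β : ℝ) (q : Polynomial ℝ) (k : ℕ) (hk : q.natDegree ≤ k) :
    (jacobiRaise α β q).coeff (k + 1) = -(α + β + k + 2) * q.coeff k := by
  have hrw : jacobiRaise α β q = Polynomial.derivative q -
      Polynomial.X * (Polynomial.X * Polynomial.derivative q) +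
        Polynomial.C (β - α) * q - Polynomial.C (α + β + 2) * (Polynomial.X * q) := by
    simp only [jacobiRaise, map_add, map_sub, map_one, map_ofNat]
    ring
  have h1 : q.coeff (k + 1) = 0 := Polynomial.coeff_eq_zero_of_natDegree_lt (by omega)
  have h2 : q.coeff (k + 1 + 1) = 0 := Polynomial.coeff_eq_zero_of_natDegree_lt (by omega)
  have h3 : (Polynomial.X * Polynomial.derivative q).coeff k = k * q.coeff k := by
    cases k with
    | zero => simp
    | succ j =>
      rw [Polynomial.coeff_X_mul, Polynomial.coeff_derivative]
      push_cast
      ring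
  rw [hrw, Polynomial.coeff_sub, Polynomial.coeff_add, Polynomial.coeff_sub,
    Polynomial.coeff_C_mul, Polynomial.coeff_C_mul, Polynomial.coeff_X_mul, Polynomial.coeff_X_mul,
    h3, Polynomial.coeff_derivative, h1, h2]
  ring

theorem jacobiWeight_add_one (α β : ℝ) {x : ℝ} (hx : x ∈ Set.Ioo (-1 : ℝ) 1) :
    jacobiWeight (α + 1) (β + 1) x = (1 - x ^ 2) * jacobiWeight α β x := by
  have h1 : 0 < 1 - x := by linarith [hx.2]
  have h2 : 0 < 1 + x := by linarith [hx.1]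
  rw [jacobiWeight, jacobiWeight, Real.rpow_add_one h1.ne', Real.rpow_add_one h2.ne']
  ring

theorem hasDerivAt_mul_jacobiWeight (α β : ℝ) (s : Polynomial ℝ) {x : ℝ}
    (hx : x ∈ Set.Ioo (-1 : ℝ) 1) :
    HasDerivAt (fun y => s.eval y * jacobiWeight (α + 1) (β + 1) y)
      ((jacobiRaise α β s).eval x * jacobiWeight α β x) x := by
  have h1 : 0 < 1 - x := by linarith [hx.2]
  have h2 : 0 < 1 + x := by linarith [hx.1]
  have d1 := ((hasDerivAt_id x).const_sub 1).rpow_const (p := α + 1) (Or.inl h1.ne')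
  have d2 := ((hasDerivAt_id x).const_add 1).rpow_const (p := β + 1) (Or.inl h2.ne')
  refine ((s.hasDerivAt x).mul (d1.mul d2)).congr_deriv ?_
  simp only [id, Pi.mul_apply, add_sub_cancel_right, jacobiRaise_eval, jacobiWeight,
    Real.rpow_add_one h1.ne', Real.rpow_add_one h2.ne']
  ring

/-- The integrand is the derivative of `s` times the weight with both exponents raised by one; these
exponents are positive, so that product is continuous on `[-1, 1]` and vanishes at both ends. -/
theorem integral_jacobiRaise {α β : ℝ} (hα : -1 < α) (hβ : -1 < β) (s : Polynomial ℝ) :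
    ∫ x in (-1 : ℝ)..1, (jacobiRaise α β s).eval x * jacobiWeight α β x = 0 := by
  have hα' : 0 < α + 1 := by linarith
  have hβ' : 0 < β + 1 := by linarith
  have hcont : Continuous fun y => s.eval y * jacobiWeight (α + 1) (β + 1) y := by
    refine s.continuous.mul (Continuous.mul ?_ ?_)
    · exact Continuous.rpow_const (by fun_prop) fun _ => Or.inr hα'.le
    · exact Continuous.rpow_const (by fun_prop) fun _ => Or.inr hβ'.le
  rw [intervalIntegral.integral_eq_sub_of_hasDerivAt_of_le (by norm_num) hcont.continuousOn
    (fun x hx => hasDerivAt_mul_jacobiWeight α β s hx)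
    (by simpa using jacobiPairing_intervalIntegrable hα hβ (jacobiRaise α β s) 1)]
  simp [jacobiWeight, Real.zero_rpow hα'.ne', Real.zero_rpow hβ'.ne']

/-- Up to sign, the raising operator is adjoint to differentiation. -/
theorem jacobiPairing_jacobiRaise {α β : ℝ} (hα : -1 < α) (hβ : -1 < β) (q r : Polynomial ℝ) :
    jacobiPairing α β (jacobiRaise α β q) r =
      -jacobiPairing (α + 1) (β + 1) q (Polynomial.derivative r) := by
  -- The factor `1 - x²` is exactly what raises both exponents of the weight by one.
  have hshift : jacobiPairing (α + 1) (β + 1) q (Polynomial.derivative r) =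
      jacobiPairing α β ((1 - Polynomial.X ^ 2) * (q * Polynomial.derivative r)) 1 := by
    refine intervalIntegral.integral_congr_Ioo_of_le (by norm_num) fun x hx => ?_
    simp only [jacobiWeight_add_one α β hx, Polynomial.eval_mul, Polynomial.eval_sub,
      Polynomial.eval_one, Polynomial.eval_pow, Polynomial.eval_X]
    ring
  have hprod : jacobiPairing α β (jacobiRaise α β q) r =
      jacobiPairing α β (jacobiRaise α β q * r) 1 := by
    simp [jacobiPairing]
  have hzero : jacobiPairing α β (jacobiRaise α β (q * r)) 1 = 0 := by
    simpa [jacobiPairing] using integral_jacobiRaise hα hβ (q * r)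
  rw [jacobiRaise_mul, jacobiPairing_add hα hβ] at hzero
  rw [hshift, hprod]
  linarith

/-- The difference has degree below `n`, so both `Q` and the Jacobi polynomial are orthogonal to it;
it is then orthogonal to itself, hence zero. -/
theorem eq_monicJacobi_of_orthogonal {α β : ℝ} (hα : -1 < α) (hβ : -1 < β) {n : ℕ}
    {Q : Polynomial ℝ} (hcoeff : Q.coeff n = 1) (hdeg : ∀ k, n < k → Q.coeff k = 0)
    (horth : ∀ r : Polynomial ℝ, r.degree < n → jacobiPairing α β Q r = 0) :
    Q = monicJacobi α β n := by
  have hJ := isMonicJacobiFamily_monicJacobi hα hβ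
  have hlead : (monicJacobi α β n).coeff n = 1 := by
    have := (hJ.monic n).coeff_natDegree
    rwa [hJ.natDegree_eq] at this
  have hlt : (Q - monicJacobi α β n).degree < (n : WithBot ℕ) := by
    rw [Polynomial.degree_lt_iff_coeff_zero]
    intro k hk
    rw [Polynomial.coeff_sub]
    rcases hk.eq_or_lt with rfl | hk
    · rw [hcoeff, hlead, sub_self]
    · rw [hdeg k hk, Polynomial.coeff_eq_zero_of_natDegree_lt (p := monicJacobi α β n)
        (by rwa [hJ.natDegree_eq]), sub_zero]
  by_contra hne
  have h := jacobiPairing_self_pos hα hβ (sub_ne_zero.2 hne)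
  rw [jacobiPairing_sub hα hβ, horth _ hlt, jacobiPairing_comm _ _ (monicJacobi α β n),
    hJ.pairing_eq_zero hα hβ n n le_rfl _ hlt, sub_self] at h
  exact lt_irrefl _ h

theorem monicJacobi_succ {α β : ℝ} (hα : -1 < α) (hβ : -1 < β) (m : ℕ) :
    monicJacobi α β (m + 1) = Polynomial.C (-(α + β + m + 2)⁻¹) *
      jacobiRaise α β (monicJacobi (α + 1) (β + 1) m) := by
  have hα' : -1 < α + 1 := by linarith
  have hβ' : -1 < β + 1 := by linarith
  have hJ := isMonicJacobiFamily_monicJacobi hα' hβ'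
  -- Positive, because `α + β > -2`.
  have hne : α + β + m + 2 ≠ 0 := by
    have : (0 : ℝ) ≤ m := m.cast_nonneg
    linarith
  have hnat := hJ.natDegree_eq m
  symm
  apply eq_monicJacobi_of_orthogonal hα hβ
  · have hlead := (hJ.monic m).coeff_natDegree
    rw [hnat] at hlead
    rw [Polynomial.coeff_C_mul, jacobiRaise_coeff_succ _ _ _ _ hnat.le, hlead]
    field_simp
  · rintro (_ | k) hk
    · omega
    · rw [Polynomial.coeff_C_mul, jacobiRaise_coeff_succ _ _ _ _ (by omega),
        Polynomial.coeff_eq_zero_of_natDegree_lt (by omega), mul_zero, mul_zero]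
  -- Moving the operator onto `r` leaves `r'`, of degree below `m`, paired with the degree `m`
  -- Jacobi polynomial for the raised parameters.
  · intro r hr
    have hr' : (Polynomial.derivative r).degree < (m : WithBot ℕ) := by
      rw [Polynomial.degree_lt_iff_coeff_zero] at hr ⊢
      intro k hk
      rw [Polynomial.coeff_derivative, hr (k + 1) (by omega), zero_mul]
    rw [jacobiPairing_C_mul, jacobiPairing_jacobiRaise hα hβ, jacobiPairing_comm,
      hJ.pairing_eq_zero hα' hβ' m m le_rfl _ hr', neg_zero, mul_zero]

theorem ascPochhammer_succ_eval_left (n : ℕ) (x : ℝ) :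
    (ascPochhammer ℝ (n + 1)).eval x = x * (ascPochhammer ℝ n).eval (x + 1) := by
  simp [ascPochhammer_succ_left]

theorem mainTheorem3 (α β : ℝ) (hα : -1 < α) (hβ : -1 < β) (n : ℕ) :
    (monicJacobi α β n).eval (-1) =
        (-1) ^ n * 2 ^ n * (ascPochhammer ℝ n).eval (β + 1) /
          (ascPochhammer ℝ n).eval (α + β + n + 1) ∧
      (monicJacobi α β n).eval 1 =
        2 ^ n * (ascPochhammer ℝ n).eval (α + 1) /
          (ascPochhammer ℝ n).eval (α + β + n + 1) := by
  -- The recursion shifts both parameters, so they must vary in the induction.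
  induction n generalizing α β with
  | zero =>
    rw [monicJacobi]
    simp
  | succ m ih =>
    obtain ⟨ih1, ih2⟩ := ih (α + 1) (β + 1) (by linarith) (by linarith)
    -- With `c = α + β + m + 2`, the inductive denominator is `(c+1)_m`; the normalising factor `c`
    -- completes it to `(c)_{m+1}`. Likewise `β + 1` and `α + 1` extend the numerators on the left.
    have hs : α + 1 + (β + 1) + m + 1 = α + β + m + 2 + 1 := by ring
    have hs' : α + β + ((m + 1 : ℕ) : ℝ) + 1 = α + β + m + 2 := by push_cast; ring
    rw [hs] at ih1 ih2
    simp only [hs', ascPochhammer_succ_eval_left, monicJacobi_succ hα hβ, Polynomial.eval_mul,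
      Polynomial.eval_C, jacobiRaise_eval, ih1, ih2, div_eq_mul_inv, mul_inv]
    -- The raising operator multiplies the value at `-1` by `2(β+1)` and the value at `1` by
    -- `-2(α+1)`; with the minus sign of the normalisation, only `-1` gains an alternating sign.
    constructor <;> ring
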